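/- Let $\mathfrak g$ be a finite-dimensional complex simple Lie algebra with Cartan subalgebra $\mathfrak h$, simple roots $\alpha_1,\dots,\alpha_l$ and corresponding set of positive roots $\phi^+$. For a root $\alpha$ let $h_\alpha\in\mathfrak h$ be its coroot, and let $h_i$ be the coroot of $\alpha_i$. Put $h^0=\sum_{\alpha\in\phi^+}h_\alpha$ and write $h^0=\sum_{i=1}^l c_ih_i$. For each $i$ choose a triple $\{E_i,F_i,H_i\}$ with $E_i\in\mathfrak g_{\alpha_i}$, $F_i\in\mathfrak g_{-\alpha_i}$, $H_i\neq 0$, $[H_i,E_i]=2E_i$, $[H_i,F_i]=-2F_i$, $[E_i,F_i]=H_i$, and put $e^0=\sum_i E_i$ and $f^0=\sum_i c_iF_i$. Let $\mathfrak a^0$ be the principal three-dimensional subalgebra spanned by $h^0,e^0,f^0$. For $\lambda=\sum_{i=1}^l a_i\alpha_i\in\mathfrak h^*$ put $\mathrm{ht}(\lambda)=\sum_{i=1}^l a_i$. Let $\lambda$ be a dominant integral weight and let $V_\lambda$ be the finite-dimensional irreducible $\mathfrak g$-module with highest weight $\lambda$. Then $\lambda(h^0)=2\,\mathrm{ht}(\lambda)$;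 the $\mathfrak a^0$-submodule of $V_\lambda$ generated by any highest weight vector (a nonzero vector of weight $\lambda$ annihilated by all positive root spaces) has dimension $2\,\mathrm{ht}(\lambda)+1$; and $V_\lambda$ is irreducible as an $\mathfrak a^0$-module if and only if $\dim V_\lambda=2\,\mathrm{ht}(\lambda)+1$. -/

import Mathlib

/-!
Throughout, `L` is a finite-dimensional simple complex Lie algebra, `H` is a Cartan subalgebra, and `b` is a base (a set of simple roots)
of the root system of `L` relative to `H`; the positive roots are those with `b.IsPos`.
-/

noncomputable section

namespace PrincipalTDS

open LieAlgebra LieAlgebra.IsKilling Module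

variable {L : Type*} [LieRing L] [LieAlgebra ℂ L] [FiniteDimensional ℂ L]
  [LieAlgebra.IsSimple ℂ L] {H : LieSubalgebra ℂ L} [H.IsCartanSubalgebra]

/-- The height of `μ = ∑ aᵢ αᵢ ∈ H*`, namely `∑ aᵢ`, where the `αᵢ` are the simple roots. -/
def ht (b : (rootSystem H).Base) (μ : Dual ℂ H) : ℂ :=
  ∑ i : b.support, b.toWeightBasis.repr μ i

/-- A weight is dominant integral if it takes values in `ℕ` on the simple coroots. -/
def IsDominantIntegral (b : (rootSystem H).Base) (μ : Dual ℂ H) : Prop :=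
  ∀ i ∈ b.support, ∃ n : ℕ, μ ((rootSystem H).coroot i) = n

/-- `v` is a highest weight vector of weight `μ`: a nonzero vector of weight `μ` which is
annihilated by all root spaces of positive roots. -/
structure IsHighestWeightVector {V : Type*} [AddCommGroup V] [Module ℂ V] [LieRingModule L V]
    [LieModule ℂ L V] (b : (rootSystem H).Base) (μ : Dual ℂ H) (v : V) : Prop where
  ne_zero : v ≠ 0
  weight : ∀ h : H, ⁅(h : L), v⁆ = μ h • v
  annihilated : ∀ α : H.root, b.IsPos α → ∀ x ∈ rootSpace H α.1, ⁅x, v⁆ = 0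

open Classical in
/-- `h⁰`, the sum of the coroots of all positive roots. -/
def h0 (b : (rootSystem H).Base) : H :=
  ∑ α : H.root with b.IsPos α, (rootSystem H).coroot α

/-- The coefficients `cᵢ` in `h⁰ = ∑ cᵢ hᵢ`, where the `hᵢ` are the simple coroots. -/
def coeff (b : (rootSystem H).Base) (i : b.support) : ℂ :=
  b.toCoweightBasis.repr (h0 b) i

/-- A choice, for every simple root `αᵢ`, of a triple `Hᵢ, Eᵢ, Fᵢ` spanning a copy of `sl₂`
with `Eᵢ` in the root space of `αᵢ` and `Fᵢ` in the root space of `-αᵢ`. -/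
structure SimpleTriples (b : (rootSystem H).Base) where
  Hh : b.support → L
  E : b.support → L
  F : b.support → L
  isSl2Triple : ∀ i, IsSl2Triple (Hh i) (E i) (F i)
  E_mem : ∀ i : b.support, E i ∈ rootSpace H i.1.1
  F_mem : ∀ i : b.support, F i ∈ rootSpace H (-i.1.1)

namespace SimpleTriples

variable {b : (rootSystem H).Base} (T : SimpleTriples b)

/-- `e⁰ = ∑ Eᵢ`. -/
def e0 : L := ∑ i : b.support, T.E i

/-- `f⁰ = ∑ cᵢ Fᵢ`. -/
def f0 : L := ∑ i : b.support, coeff b i • T.F i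

end SimpleTriples

theorem simple_root_h0 (b : (rootSystem H).Base) (i : b.support) :
    (rootSystem H).root i (h0 b) = 2 := by
  classical
  have hi := i.2
  have hpos : b.IsPos (i : H.root) := b.isPos_of_mem_support hi
  have hmem : (i : H.root) ∈ Finset.univ.filter (fun α : H.root => b.IsPos α) := by
    simpa using hpos
  have e : h0 b = (∑ α ∈ (Finset.univ.filter (fun α : H.root => b.IsPos α)).erase i,
      (rootSystem H).coroot α) + (rootSystem H).coroot i := by
    rw [Finset.sum_erase_add _ _ hmem, h0]
  have perm : ∀ α ∈ (Finset.univ.filter (fun α : H.root => b.IsPos α)).erase i,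
      (rootSystem H).reflectionPerm i α ∈
        (Finset.univ.filter (fun α : H.root => b.IsPos α)).erase i := by
    intro α hα
    simp only [Finset.mem_erase, Finset.mem_filter, Finset.mem_univ, true_and] at hα ⊢
    refine ⟨fun h => ?_, RootPairing.Base.IsPos.reflectionPerm hα.2 hi hα.1⟩
    have h3 : α = (rootSystem H).reflectionPerm i i := by
      exact ((rootSystem H).reflectionPerm i).injective (by simp [h])
    let := (rootSystem H).indexNeg
    refine (RootPairing.Base.IsPos.neg_iff_not b (i : H.root)).mp ?_ hpos
    have := hα.2
    rw [h3] at this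
    exact this
  have key : (rootSystem H).coreflection i (h0 b - (rootSystem H).coroot i) =
      h0 b - (rootSystem H).coroot i := by
    rw [e, add_sub_cancel_right, map_sum]
    refine Finset.sum_bij (fun α _ => (rootSystem H).reflectionPerm i α) perm ?_ ?_ ?_
    · intro α _ β _ h
      exact ((rootSystem H).reflectionPerm i).injective h
    · intro α hα
      exact ⟨(rootSystem H).reflectionPerm i α, perm α hα, by simp⟩
    · intro α _
      rw [RootPairing.coroot_reflectionPerm]
  rw [RootPairing.coreflection_apply, sub_eq_self, smul_eq_zero] at key
  have hne : (rootSystem H).coroot i ≠ 0 := (rootSystem H).flip.ne_zero _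
  have h1 := key.resolve_right hne
  rw [map_sub, sub_eq_zero] at h1
  exact h1.trans (RootPairing.root_coroot_two _ _)

theorem nonempty_support (b : (rootSystem H).Base) : Nonempty b.support := by
  by_contra hne
  rw [not_nonempty_iff] at hne
  have h1 : Subsingleton (Dual ℂ H) := b.toWeightBasis.repr.toEquiv.subsingleton
  have h2 : ∀ x : H, x = 0 := fun x =>
    (Module.forall_dual_apply_eq_zero_iff ℂ x).mp fun f => by rw [Subsingleton.elim f 0]; rfl
  apply LieAlgebra.IsSimple.non_abelian ℂ (L := L)
  have h3 : ∀ x : L, x ∈ H := by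
    intro x
    rw [← LieSubalgebra.IsCartanSubalgebra.self_normalizing (H := H),
      LieSubalgebra.mem_normalizer_iff]
    intro y hy
    have : y = 0 := congrArg Subtype.val (h2 ⟨y, hy⟩)
    simp [this]
  refine ⟨fun x y => ?_⟩
  have : x = 0 := congrArg Subtype.val (h2 ⟨x, h3 x⟩)
  simp [this]

theorem sum_coeff (b : (rootSystem H).Base) :
    ∑ i : b.support, coeff b i • (rootSystem H).coroot i = h0 b := by
  simpa [coeff] using b.toCoweightBasis.sum_repr (h0 b)

namespace SimpleTriples

variable {b : (rootSystem H).Base} (T : SimpleTriples b)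

theorem lie_E_F_same (i : b.support) :
    ⁅T.E i, T.F i⁆ = ((rootSystem H).coroot i : L) := by
  rw [(T.isSl2Triple i).lie_e_f]
  exact (T.isSl2Triple i).h_eq_coroot (H.isNonZero_coe_root i.1) (T.E_mem i) (T.F_mem i)

theorem lie_E_F_ne {i j : b.support} (hij : i ≠ j) : ⁅T.E i, T.F j⁆ = 0 := by
  have h := lie_mem_genWeightSpace_of_mem_genWeightSpace (T.E_mem i) (T.F_mem j)
  by_contra hne
  have hbot : rootSpace H ((i.1.1 : H → ℂ) + (-j.1.1 : LieModule.Weight ℂ H L)) ≠ ⊥ := by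
    intro hb
    replace h : ⁅T.E i, T.F j⁆ ∈ rootSpace H ((i.1.1 : H → ℂ) + (-j.1.1 : LieModule.Weight ℂ H L)) := h
    rw [hb] at h
    exact hne (by simpa using h)
  let w : LieModule.Weight ℂ H L := ⟨_, hbot⟩
  have hw : w.toLinear = (rootSystem H).root i - (rootSystem H).root j := by
    ext x
    simp [w, sub_eq_add_neg]
  by_cases hz : w.IsZero
  · apply hij
    apply Subtype.ext
    apply (rootSystem H).root.injective
    rw [← sub_eq_zero, ← hw]
    ext x
    have := congrFun hz x
    simpa using this
  · exact b.sub_notMem_range_root i.2 j.2 ⟨⟨w, by simpa using hz⟩, hw⟩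

theorem isSl2Triple_principal : IsSl2Triple (h0 b : L) T.e0 T.f0 where
  h_ne_zero h := by
    obtain ⟨i⟩ := nonempty_support b
    have h1 := simple_root_h0 b i
    have h2 : h0 b = 0 := Subtype.ext h
    rw [h2, map_zero] at h1
    norm_num at h1
  lie_e_f := by
    rw [e0, f0, sum_lie_sum]
    have h1 : ((h0 b : H) : L) = ∑ i : b.support, coeff b i • ((rootSystem H).coroot i : L) := by
      rw [← sum_coeff b]
      simp
    rw [h1]
    refine Finset.sum_congr rfl fun i _ => ?_
    rw [Finset.sum_eq_single i]
    · rw [lie_smul, T.lie_E_F_same]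
    · intro j _ hj
      rw [lie_smul, T.lie_E_F_ne hj.symm, smul_zero]
    · simp
  lie_h_e_nsmul := by
    rw [e0, lie_sum, Finset.smul_sum]
    refine Finset.sum_congr rfl fun i _ => ?_
    have h1 := lie_eq_smul_of_mem_rootSpace (T.E_mem i) (h0 b)
    have h2 : i.1.1 (h0 b) = 2 := simple_root_h0 b i
    rw [h2] at h1
    rw [← ofNat_smul_eq_nsmul ℂ]
    exact h1
  lie_h_f_nsmul := by
    rw [f0, lie_sum, Finset.smul_sum, ← Finset.sum_neg_distrib]
    refine Finset.sum_congr rfl fun i _ => ?_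
    have h1 := lie_eq_smul_of_mem_rootSpace (T.F_mem i) (h0 b)
    have h2 : i.1.1 (h0 b) = 2 := simple_root_h0 b i
    have h3 : ⁅(h0 b : L), T.F i⁆ = -((2 : ℂ) • T.F i) := by
      rw [← neg_smul, ← h2]
      exact h1
    rw [lie_smul, h3, ← ofNat_smul_eq_nsmul ℂ, smul_neg, smul_comm]

/-- The principal three-dimensional subalgebra `a⁰`, the linear span of `e⁰`, `f⁰`, `h⁰`. -/
def a0 : LieSubalgebra ℂ L :=
  T.isSl2Triple_principal.toLieSubalgebra ℂ

end SimpleTriples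
end PrincipalTDS
end

namespace IsSl2Triple

open LieModule Module Submodule

/-! Every simple root takes the value 2 on `h⁰`, so `μ(h⁰) = 2 ht(μ)` by linearity. A highest weight
vector `v` is killed by every `Eᵢ`, hence by `e⁰`, so it is primitive for the principal triple with
weight `n = 2 ht(μ)`, a natural number because `V` is finite-dimensional. The rest is `sl₂` theory:
`v, f v, …, fⁿ v` is a basis of the submodule generated by `v` (`finrank_lieSpan`). Any nonzero
vector of that submodule is carried back to a multiple of `v` by a power of `e`, so the submodule is
irreducible, and `V` is irreducible exactly when the two dimensions agree
(`isIrreducible_iff_finrank`). -/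

theorem lie_mem_of_lie_mem {R L M : Type*} [CommRing R] [LieRing L] [LieAlgebra R L]
    [AddCommGroup M] [Module R M] [LieRingModule L M] [LieModule R L M] {h e f : L}
    (t : IsSl2Triple h e f) (N : Submodule R M) (he : ∀ m ∈ N, ⁅e, m⁆ ∈ N)
    (hf : ∀ m ∈ N, ⁅f, m⁆ ∈ N) {x : L} (hx : x ∈ t.toLieSubalgebra R) {m : M} (hm : m ∈ N) :
    ⁅x, m⁆ ∈ N := by
  obtain ⟨a, c, d, rfl⟩ := mem_toLieSubalgebra_iff.mp hx
  simp only [add_lie, smul_lie, lie_lie]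
  exact add_mem (add_mem (N.smul_mem _ (he _ hm)) (N.smul_mem _ (hf _ hm)))
    (N.smul_mem _ (sub_mem (he _ (hf _ hm)) (hf _ (he _ hm))))

namespace HasPrimitiveVectorWith

variable {k L M : Type*} [Field k] [LieRing L] [LieAlgebra k L]
  [AddCommGroup M] [Module k M] [LieRingModule L M] [LieModule k L M]
  {h e f : L} {t : IsSl2Triple h e f} {m : M} {n : ℕ}

/-- Each `e` removes one `f` up to a scalar, and `e` kills `m`. -/
theorem pow_toEnd_e_pow_toEnd_f_eq_zero (P : HasPrimitiveVectorWith t m (n : k)) {i j : ℕ}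
    (hij : i < j) : (toEnd k L M e ^ j) ((toEnd k L M f ^ i) m) = 0 := by
  induction j generalizing i with
  | zero => lia
  | succ j ih =>
    rw [pow_succ (toEnd k L M e), Module.End.mul_apply, toEnd_apply_apply]
    cases i with
    | zero => simp [P.lie_e]
    | succ i => rw [P.lie_e_pow_succ_toEnd_f, map_smul, ih (by lia), smul_zero]

variable [CharZero k]

/-- The vectors `m, f m, …, fⁿ m` are linearly independent when `m` is primitive of weight `n`. -/
theorem linearIndependent_pow_toEnd_f (P : HasPrimitiveVectorWith t m (n : k)) :
    LinearIndependent k fun i : Fin (n + 1) ↦ (toEnd k L M f ^ (i : ℕ)) m := by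
  -- The `h`-eigenvalues `n - 2i` are distinct in characteristic zero.
  refine End.eigenvectors_linearIndependent' (toEnd k L M h)
    (fun i : Fin (n + 1) ↦ (n : k) - 2 * (i : ℕ)) (fun i j hij ↦ ?_) _ fun i ↦ ?_
  · simpa [Fin.ext_iff] using hij
  · refine ⟨End.mem_eigenspace_iff.mpr (P.lie_h_pow_toEnd_f i), ?_⟩
    exact P.pow_toEnd_f_ne_zero_of_eq_nat rfl (Nat.lt_succ_iff.mp i.2)

/-- The scalar is the product of `(r + 1)(n - r)` over `r < i`, whose factors vanish only at `r =
n`. -/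
theorem pow_toEnd_e_pow_toEnd_f (P : HasPrimitiveVectorWith t m (n : k)) {i : ℕ} (hi : i ≤ n) :
    ∃ c : k, c ≠ 0 ∧ (toEnd k L M e ^ i) ((toEnd k L M f ^ i) m) = c • m := by
  induction i with
  | zero => exact ⟨1, one_ne_zero, by simp⟩
  | succ i ih =>
    obtain ⟨c, hc, hcm⟩ := ih (by lia)
    refine ⟨(i + 1) * (n - i) * c, mul_ne_zero (mul_ne_zero (Nat.cast_add_one_ne_zero i) ?_) hc, ?_⟩
    · rw [sub_ne_zero]
      exact_mod_cast (show n ≠ i by lia)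
    · rw [pow_succ (toEnd k L M e), Module.End.mul_apply, toEnd_apply_apply,
        P.lie_e_pow_succ_toEnd_f, map_smul, hcm, smul_smul]

/-- A nonzero vector in the span of `m, f m, …, fⁿ m` generates `m` under the action of `e`. -/
theorem mem_of_lie_e_mem (P : HasPrimitiveVectorWith t m (n : k)) (N : Submodule k M)
    (he : ∀ x ∈ N, ⁅e, x⁆ ∈ N) {w : M} (hw : w ∈ N) (hw0 : w ≠ 0)
    (hws : w ∈ span k (Set.range fun i : Fin (n + 1) ↦ (toEnd k L M f ^ (i : ℕ)) m)) :
    m ∈ N := by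
  have he_pow (j : ℕ) {x : M} (hx : x ∈ N) : (toEnd k L M e ^ j) x ∈ N := by
    induction j with
    | zero => simpa
    | succ j ih =>
      rw [pow_succ', Module.End.mul_apply]
      exact he _ ih
  -- Induction on the length of the expansion of `w` discards zero top coefficients until a nonzero
  -- one is reached.
  suffices ∀ j ≤ n + 1, ∀ a : ℕ → k,
      w = ∑ i ∈ Finset.range j, a i • (toEnd k L M f ^ i) m → m ∈ N by
    obtain ⟨a, ha⟩ := mem_span_range_iff_exists_fun k |>.mp hws
    refine this (n + 1) le_rfl (fun i ↦ if hi : i < n + 1 then a ⟨i, hi⟩ else 0) ?_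
    rw [Finset.sum_range, ← ha]
    exact Finset.sum_congr rfl fun i _ ↦ by rw [dif_pos i.2]
  intro j
  induction j with
  | zero => exact fun _ a ha ↦ absurd (by simpa using ha) hw0
  | succ j ih =>
    intro hj a ha
    by_cases haj : a j = 0
    · exact ih (by lia) a (by simpa [Finset.sum_range_succ, haj] using ha)
    · obtain ⟨c, hc, hcm⟩ := P.pow_toEnd_e_pow_toEnd_f (i := j) (by lia)
      -- Applying `eʲ` kills all terms below the top one and leaves a nonzero multiple of `m`.
      have hmem := he_pow j hw
      rw [ha, Finset.sum_range_succ, map_add, map_sum, map_smul, hcm, smul_smul,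
        Finset.sum_eq_zero fun i hi ↦ by
          rw [map_smul, P.pow_toEnd_e_pow_toEnd_f_eq_zero (Finset.mem_range.mp hi), smul_zero],
        zero_add] at hmem
      exact (N.smul_mem_iff (mul_ne_zero haj hc)).mp hmem

variable [FiniteDimensional k M]

theorem lieSpan_toSubmodule_eq_span (P : HasPrimitiveVectorWith t m (n : k)) :
    (LieSubmodule.lieSpan k (t.toLieSubalgebra k) {m}).toSubmodule =
      span k (Set.range fun i : Fin (n + 1) ↦ (toEnd k L M f ^ (i : ℕ)) m) := by
  set S := span k (Set.range fun i : Fin (n + 1) ↦ (toEnd k L M f ^ (i : ℕ)) m) with hS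
  have hpow (i : ℕ) (hi : i ≤ n) : (toEnd k L M f ^ i) m ∈ S :=
    subset_span ⟨⟨i, Nat.lt_succ_iff.mpr hi⟩, rfl⟩
  have hstable (x : L) (hx : ∀ i ≤ n, ⁅x, (toEnd k L M f ^ i) m⁆ ∈ S) (y : M) (hy : y ∈ S) :
      ⁅x, y⁆ ∈ S := by
    refine (span_le (p := S.comap (toEnd k L M x))).mpr ?_ hy
    rintro _ ⟨i, rfl⟩
    exact hx i (Nat.lt_succ_iff.mp i.2)
  have he := hstable e fun i hi ↦ by
    cases i with
    | zero => simp [P.lie_e]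
    | succ i =>
      rw [P.lie_e_pow_succ_toEnd_f]
      exact S.smul_mem _ (hpow i (by lia))
  have hf := hstable f fun i hi ↦ by
    rw [P.lie_f_pow_toEnd_f]
    -- At the end of the string, `fⁿ⁺¹ m = 0` because `M` is finite-dimensional.
    rcases hi.eq_or_lt with rfl | hi
    · rw [P.pow_toEnd_f_eq_zero_of_eq_nat rfl]
      exact S.zero_mem
    · exact hpow _ hi
  apply le_antisymm
  · let N : LieSubmodule k (t.toLieSubalgebra k) M :=
      { S with lie_mem := fun {x y} hy ↦ t.lie_mem_of_lie_mem S he hf x.2 hy }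
    have hN : LieSubmodule.lieSpan k (t.toLieSubalgebra k) {m} ≤ N :=
      LieSubmodule.lieSpan_le.mpr <| Set.singleton_subset_iff.mpr <| hpow 0 (Nat.zero_le n)
    exact hN
  · rw [hS, span_le]
    rintro _ ⟨⟨i, hi⟩, rfl⟩
    have hfmem : f ∈ t.toLieSubalgebra k := mem_toLieSubalgebra_iff.mpr ⟨0, 1, 0, by simp⟩
    change (toEnd k L M f ^ i) m ∈ _
    clear hi
    induction i with
    | zero => exact LieSubmodule.subset_lieSpan rfl
    | succ i ih =>
      simp only [pow_succ', Module.End.mul_apply]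
      exact LieSubmodule.lie_mem _ (x := (⟨f, hfmem⟩ : t.toLieSubalgebra k)) ih

theorem finrank_lieSpan (P : HasPrimitiveVectorWith t m (n : k)) :
    finrank k (LieSubmodule.lieSpan k (t.toLieSubalgebra k) {m}) = n + 1 := by
  change finrank k (LieSubmodule.lieSpan k (t.toLieSubalgebra k) {m}).toSubmodule = n + 1
  rw [P.lieSpan_toSubmodule_eq_span, finrank_span_eq_card P.linearIndependent_pow_toEnd_f,
    Fintype.card_fin]

/-- A module with a primitive vector of weight `n` is irreducible over the span of the triple if
and only if it has dimension `n + 1`. -/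
theorem isIrreducible_iff_finrank (P : HasPrimitiveVectorWith t m (n : k)) :
    LieModule.IsIrreducible k (t.toLieSubalgebra k) M ↔ finrank k M = n + 1 := by
  have hm : m ∈ LieSubmodule.lieSpan k (t.toLieSubalgebra k) {m} :=
    LieSubmodule.subset_lieSpan rfl
  constructor
  · intro hirr
    have htop : LieSubmodule.lieSpan k (t.toLieSubalgebra k) {m} = ⊤ := by
      refine (eq_bot_or_eq_top _).resolve_left fun hbot ↦ P.ne_zero ?_
      rwa [hbot, LieSubmodule.mem_bot] at hm
    rw [← P.finrank_lieSpan, htop]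
    exact (finrank_top k M).symm
  · intro hdim
    have htop : (LieSubmodule.lieSpan k (t.toLieSubalgebra k) {m}).toSubmodule = ⊤ :=
      eq_top_of_finrank_eq (P.finrank_lieSpan.trans hdim.symm)
    have : Nontrivial M := ⟨m, 0, P.ne_zero⟩
    -- The string of `m` now spans `M`, so any nonzero `N` contains `m` and hence everything.
    refine LieModule.IsIrreducible.mk fun N hN ↦ ?_
    obtain ⟨w, hw, hw0⟩ := Submodule.exists_mem_ne_zero_of_ne_bot
      (fun hbot ↦ hN (LieSubmodule.toSubmodule_eq_bot N |>.mp hbot))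
    have hemem : e ∈ t.toLieSubalgebra k := mem_toLieSubalgebra_iff.mpr ⟨1, 0, 0, by simp⟩
    have hmN : m ∈ N := P.mem_of_lie_e_mem N.toSubmodule
      (fun x hx ↦ N.lie_mem (x := (⟨e, hemem⟩ : t.toLieSubalgebra k)) hx) hw hw0
      (by rw [← P.lieSpan_toSubmodule_eq_span, htop]; trivial)
    have hle : LieSubmodule.lieSpan k (t.toLieSubalgebra k) {m} ≤ N :=
      LieSubmodule.lieSpan_le.mpr (Set.singleton_subset_iff.mpr hmN)
    refine eq_top_iff.mpr fun x _ ↦ hle ?_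
    rw [← LieSubmodule.mem_toSubmodule, htop]
    trivial

end HasPrimitiveVectorWith

end IsSl2Triple

namespace PrincipalTDS

open LieAlgebra LieAlgebra.IsKilling Module

variable {L : Type*} [LieRing L] [LieAlgebra ℂ L] [FiniteDimensional ℂ L]
  [LieAlgebra.IsSimple ℂ L] {H : LieSubalgebra ℂ L} [H.IsCartanSubalgebra]

theorem apply_h0_eq_two_mul_ht (b : (rootSystem H).Base) (μ : Dual ℂ H) :
    μ (h0 b) = 2 * ht b μ := by
  conv_lhs => rw [← b.toWeightBasis.sum_repr μ]
  simp only [LinearMap.sum_apply, LinearMap.smul_apply, RootPairing.Base.toWeightBasis_apply,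
    simple_root_h0, smul_eq_mul, ht, Finset.mul_sum]
  exact Finset.sum_congr rfl fun i _ ↦ mul_comm _ _

theorem SimpleTriples.hasPrimitiveVectorWith {b : (rootSystem H).Base} (T : SimpleTriples b)
    {V : Type*} [AddCommGroup V] [Module ℂ V] [LieRingModule L V] [LieModule ℂ L V]
    {μ : Dual ℂ H} {v : V} (hv : IsHighestWeightVector b μ v) :
    T.isSl2Triple_principal.HasPrimitiveVectorWith v (μ (h0 b)) where
  ne_zero := hv.ne_zero
  lie_h := hv.weight _
  lie_e := by
    rw [e0, sum_lie]
    exact Finset.sum_eq_zero fun i _ ↦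
      hv.annihilated i (b.isPos_of_mem_support i.2) _ (T.E_mem i)

end PrincipalTDS

/-- Let `V = V_μ` be the finite-dimensional irreducible module of highest weight `μ` of a simple
complex Lie algebra `L`. Then `μ(h⁰) = 2 ht(μ)`, the `a⁰`-submodule generated by any highest weight
vector has dimension `2 ht(μ) + 1`, and `V` is irreducible as an `a⁰`-module if and only if
`dim V = 2 ht(μ) + 1`. -/
theorem lemma4p2 {L : Type*} [LieRing L] [LieAlgebra ℂ L] [FiniteDimensional ℂ L]
    [LieAlgebra.IsSimple ℂ L] (H : LieSubalgebra ℂ L) [H.IsCartanSubalgebra]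
    (b : (LieAlgebra.IsKilling.rootSystem H).Base)
    (T : PrincipalTDS.SimpleTriples b)
    {V : Type*} [AddCommGroup V] [Module ℂ V] [LieRingModule L V] [LieModule ℂ L V]
    [FiniteDimensional ℂ V] [LieModule.IsIrreducible ℂ L V]
    (μ : Module.Dual ℂ H) (hdom : PrincipalTDS.IsDominantIntegral b μ)
    (hμ : ∃ v : V, PrincipalTDS.IsHighestWeightVector b μ v) :
    μ (PrincipalTDS.h0 b) = 2 * PrincipalTDS.ht b μ ∧
    (∀ v : V, PrincipalTDS.IsHighestWeightVector b μ v →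
      (Module.finrank ℂ (LieSubmodule.lieSpan ℂ T.a0 ({v} : Set V)) : ℂ) =
        2 * PrincipalTDS.ht b μ + 1) ∧
    (LieModule.IsIrreducible ℂ T.a0 V ↔
      (Module.finrank ℂ V : ℂ) = 2 * PrincipalTDS.ht b μ + 1) := by

  have hprim (v : V) (hv : PrincipalTDS.IsHighestWeightVector b μ v) :
      ∃ n : ℕ, 2 * PrincipalTDS.ht b μ = n ∧
        T.isSl2Triple_principal.HasPrimitiveVectorWith v (n : ℂ) := by
    have P := T.hasPrimitiveVectorWith hv
    -- Finite-dimensionality of `V` forces the weight of a primitive vector to be a natural number.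
    obtain ⟨n, hn⟩ := P.exists_nat
    exact ⟨n, (PrincipalTDS.apply_h0_eq_two_mul_ht b μ).symm.trans hn, hn ▸ P⟩
  refine ⟨PrincipalTDS.apply_h0_eq_two_mul_ht b μ, fun v hv ↦ ?_, ?_⟩
  · obtain ⟨n, hn, P⟩ := hprim v hv
    rw [hn]
    exact_mod_cast P.finrank_lieSpan
  · obtain ⟨v, hv⟩ := hμ
    obtain ⟨n, hn, P⟩ := hprim v hv
    rw [hn]
    exact P.isIrreducible_iff_finrank.trans (by norm_cast)
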